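/- Let $G$ be a compact Lie group with normalised Haar measure, let $1\le p_1,p_2<\infty$ and $0<r\le 1$, and put $\widetilde p_1=\min\{2,p_1\}$, $\widetilde p_2=\max\{2,p_2\}$. Let $\widehat G$ be the set of unitary equivalence classes of continuous irreducible unitary representations of $G$. From each class $[\xi]\in\widehat G$ choose a representative, written in an orthonormal basis of its representation space as a unitary-matrix-valued function $\xi:G\to\mathbb C^{d_\xi\times d_\xi}$, where $d_\xi$ is its dimension. Let $A:L^{p_1}(G)\to L^{p_2}(G)$ be a continuous linear operator whose matrix-valued symbol $$\sigma_A(x,\xi)=\xi(x)^*(A\xi)(x),\qquad (A\xi(x))_{ij}=(A\xi_{ij})(x),$$ does not depend on $x$ (that is, $A$ is left-invariant), $\sigma_A(x,\xi)=\sigma_A(\xi)$ for almost every $x\in G$, and is a diagonal matrix for every $[\xi]\in\widehat G$. Assume that $$\sum_{[\xi]\in\widehat G} d_\xi^{\,1+\left(\frac1{\widetilde p_1}-\frac1{\widetilde p_2}\right)r}\,\|\sigma_A(\xi)\|_{S_r}^r<\infty,$$ where $\|M\|_{S_r}=\left(\operatorname{Tr}|M|^r\right)^{1/r}$ with $|M|=(M^*M)^{1/2}$.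 Then $A:L^{p_1}(G)\to L^{p_2}(G)$ is $r$-nuclear: there are continuous linear functionals $x_n'$ on $L^{p_1}(G)$ and functions $y_n\in L^{p_2}(G)$, $n\ge 1$, such that $$Af=\sum_{n=1}^\infty\langle f,x_n'\rangle\,y_n\quad\text{for all } f\in L^{p_1}(G),\qquad\text{and}\qquad \sum_{n=1}^\infty\|x_n'\|^r\,\|y_n\|_{L^{p_2}(G)}^r<\infty.$$ -/

import Mathlib

open MeasureTheory
open scoped ENNReal Matrix ContDiff Manifold MatrixOrder

noncomputable section

/-- A linear map `T : E → F` of Banach spaces is `r`-nuclear if `T x = ∑ ⟨x, x'ₙ⟩ yₙ` for all `x`,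
for some sequences `x'ₙ` in the dual of `E` and `yₙ` in `F` with `∑ ‖x'ₙ‖ ^ r ‖yₙ‖ ^ r < ∞`. -/
def IsRNuclear {E F : Type*} [NormedAddCommGroup E] [NormedSpace ℂ E]
    [NormedAddCommGroup F] [NormedSpace ℂ F] (r : ℝ) (T : E →ₗ[ℂ] F) : Prop :=
  ∃ (x' : ℕ → StrongDual ℂ E) (y : ℕ → F),
    (Summable fun n => ‖x' n‖ ^ r * ‖y n‖ ^ r) ∧
    ∀ x : E, HasSum (fun n => x' n x • y n) (T x)

/-- The Schatten (quasi-)norm `‖M‖_{S_r} = (Tr |M| ^ r) ^ (1 / r)` of a square matrix, where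
`|M| = (M* M) ^ (1 / 2)`. -/
def schattenNorm {n : Type*} [Fintype n] [DecidableEq n] (r : ℝ) (M : Matrix n n ℂ) : ℝ :=
  (Matrix.trace (CFC.abs M ^ r)).re ^ (1 / r)

/-- A continuous irreducible unitary representation of `G`, written as a unitary-matrix-valued
function through an orthonormal basis of the representation space. (For compact `G` every
continuous irreducible unitary representation is finite-dimensional.) -/
structure IrrepMatrix (G : Type*) [Group G] [TopologicalSpace G] where
  /-- the dimension of the representation space -/
  dim : ℕ
  /-- the representation -/
  rep : G →* Matrix.unitaryGroup (Fin dim) ℂ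
  continuous_rep : Continuous rep
  dim_pos : 0 < dim
  /-- there are no invariant subspaces but the trivial ones -/
  irreducible : ∀ W : Submodule ℂ (Fin dim → ℂ),
    (∀ g : G, ∀ v ∈ W, (rep g : Matrix (Fin dim) (Fin dim) ℂ) *ᵥ v ∈ W) → W = ⊥ ∨ W = ⊤

namespace IrrepMatrix

variable {G : Type*} [Group G] [TopologicalSpace G]

/-- The matrix `ξ(x)`. -/
def mat (ξ : IrrepMatrix G) (x : G) : Matrix (Fin ξ.dim) (Fin ξ.dim) ℂ := ξ.rep x

/-- The matrix coefficient `ξ_{ij}`, a continuous function on `G`. -/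
def coeff (ξ : IrrepMatrix G) (i j : Fin ξ.dim) : C(G, ℂ) where
  toFun x := ξ.mat x i j
  continuous_toFun := (continuous_subtype_val.comp ξ.continuous_rep).matrix_elem i j

/-- Unitary equivalence: there is a unitary `U` with `ξ(x) U = U η(x)` for all `x`. -/
def Equivalent (ξ η : IrrepMatrix G) : Prop :=
  ∃ U : Matrix (Fin ξ.dim) (Fin η.dim) ℂ,
    U * Uᴴ = 1 ∧ Uᴴ * U = 1 ∧ ∀ x : G, ξ.mat x * U = U * η.mat x

/-- Unitary equivalence is an equivalence relation. -/
instance setoid (G : Type*) [Group G] [TopologicalSpace G] : Setoid (IrrepMatrix G) where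
  r := Equivalent
  iseqv :=
    { refl := fun ξ => ⟨1, by simp, by simp, by simp⟩
      symm := by
        rintro ξ η ⟨U, h1, h2, h⟩
        refine ⟨Uᴴ, by simpa using h2, by simpa using h1, fun x => ?_⟩
        calc η.mat x * Uᴴ = Uᴴ * U * (η.mat x * Uᴴ) := by rw [h2, Matrix.one_mul]
          _ = Uᴴ * (U * η.mat x) * Uᴴ := by simp only [Matrix.mul_assoc]
          _ = Uᴴ * (ξ.mat x * U) * Uᴴ := by rw [h]
          _ = Uᴴ * ξ.mat x * (U * Uᴴ) := by simp only [Matrix.mul_assoc]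
          _ = Uᴴ * ξ.mat x := by rw [h1, Matrix.mul_one]
      trans := by
        rintro ξ η ζ ⟨U, h1, h2, h⟩ ⟨V, k1, k2, k⟩
        refine ⟨U * V, ?_, ?_, fun x => ?_⟩
        · calc U * V * (U * V)ᴴ = U * (V * Vᴴ) * Uᴴ := by
                simp only [Matrix.conjTranspose_mul, Matrix.mul_assoc]
            _ = 1 := by rw [k1, Matrix.mul_one, h1]
        · calc (U * V)ᴴ * (U * V) = Vᴴ * (Uᴴ * U) * V := by
                simp only [Matrix.conjTranspose_mul, Matrix.mul_assoc]
            _ = 1 := by rw [h2, Matrix.mul_one, k2]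
        · rw [← Matrix.mul_assoc, h, Matrix.mul_assoc, k, Matrix.mul_assoc] }

end IrrepMatrix

/-- The unitary dual `Ĝ`: equivalence classes of continuous irreducible unitary representations. -/
def UnitaryDual (G : Type*) [Group G] [TopologicalSpace G] : Type _ :=
  Quotient (IrrepMatrix.setoid G)

/-- The equivalence class `[ξ]`. -/
def UnitaryDual.mk {G : Type*} [Group G] [TopologicalSpace G] (ξ : IrrepMatrix G) :
    UnitaryDual G :=
  Quotient.mk (IrrepMatrix.setoid G) ξ

/-- The matrix-valued symbol `σ_A(x, ξ) = ξ(x)* (A ξ)(x)`, where `A` is applied to each entry of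
`ξ`; as `A` takes values in `L^p`, it is determined for almost every `x`. -/
def matrixSymbol {G : Type*} [Group G] [TopologicalSpace G] [CompactSpace G]
    [MeasurableSpace G] [BorelSpace G] {μ : Measure G} [IsFiniteMeasure μ]
    {p₁ p₂ : ℝ≥0∞} [Fact (1 ≤ p₁)] [Fact (1 ≤ p₂)] (A : Lp ℂ p₁ μ →L[ℂ] Lp ℂ p₂ μ)
    (ξ : IrrepMatrix G) (x : G) : Matrix (Fin ξ.dim) (Fin ξ.dim) ℂ :=
  (ξ.mat x)ᴴ * Matrix.of fun i j => A (ContinuousMap.toLp p₁ μ ℂ (ξ.coeff i j)) x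

end

/-! Multiplying `σ_A = ξ* (A ξ)` by `ξ` gives `A ξ_ij = σ_jj ξ_ij` when the symbol is constant and
diagonal. The Fourier expansion of `f` then suggests `A f = ∑ d_ξ σ(ξ)_jj (∫ f conj ξ_ij) ξ_ij`, a
series of rank one operators, and this is the nuclear representation.

Schur orthogonality gives `∫ |ξ_ij|² = 1/d`, and `|ξ_ij| ≤ 1` by unitarity, so `‖ξ_ij‖_q ≤ d ^ (-1 /
max 2 q)` (`IrrepMatrix.norm_toLp_coeff_le`). Taking `q = p₂` and `q = p₁'`, each rank one term has
norm at most `d ^ (1/p̃₁ - 1/p̃₂) |σ_jj|`. Every `σ_jj` occurs for `d` values of `i`, and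
`‖σ‖_{S_r}^r = ∑ |σ_jj|^r` for diagonal `σ`, so the `r`-th powers are dominated by the assumed
series. Since `r ≤ 1`, the series converges in operator norm. Its sum agrees with `A` on matrix
coefficients, hence everywhere once their span is dense (`IsRNuclear.of_eqOn_dense`).

That density is the Peter–Weyl theorem (`dense_map_matrixCoeffSpan`). Convolution with a hermitian
kernel is compact, self-adjoint and commutes with left translations, so its nonzero eigenspaces are
finite-dimensional invariant spaces of continuous functions; these split into irreducibles, which
consist of matrix coefficients. By the spectral theorem a function orthogonal to all coefficients is
killed by every such convolution, and approximate identities force it to vanish. Convolving once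
more upgrades `L²` density to uniform density. -/

open Filter Topology
open scoped ComplexConjugate

set_option linter.unusedSectionVars false

/-! ### Convolution operators and approximate identities on a compact group -/

section Convolution

variable {G : Type*} [TopologicalSpace G] [Group G] [IsTopologicalGroup G]

/-- Left translation `(λ_g f)(x) = f(g⁻¹ x)` on continuous functions. -/
noncomputable def leftTranslate (g : G) : C(G, ℂ) →ₗ[ℂ] C(G, ℂ) where
  toFun f := f.comp ⟨fun x => g⁻¹ * x, by fun_prop⟩
  map_add' _ _ := rfl
  map_smul' _ _ := rfl

@[simp]
lemma leftTranslate_apply (g : G) (f : C(G, ℂ)) (x : G) :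
    leftTranslate g f x = f (g⁻¹ * x) := rfl

lemma leftTranslate_mul (g h : G) (f : C(G, ℂ)) :
    leftTranslate (g * h) f = leftTranslate g (leftTranslate h f) := by
  ext x; simp [mul_assoc]

@[simp]
lemma leftTranslate_one (f : C(G, ℂ)) : leftTranslate 1 f = f := by
  ext x; simp

lemma continuous_leftTranslate (f : C(G, ℂ)) : Continuous fun g => leftTranslate g f := by
  have h : Continuous fun p : G × G => f (p.1⁻¹ * p.2) := by fun_prop
  exact (ContinuousMap.curry ⟨_, h⟩).continuous

variable [CompactSpace G] [MeasurableSpace G] [BorelSpace G]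
  (μ : Measure G)

lemma norm_leftTranslate_le (g : G) (f : C(G, ℂ)) : ‖leftTranslate g f‖ ≤ ‖f‖ :=
  (ContinuousMap.norm_le _ (norm_nonneg _)).2 fun _ => f.norm_coe_le_norm _

lemma inner_leftTranslate [IsFiniteMeasure μ] [μ.IsMulLeftInvariant] (g : G) (f h : C(G, ℂ)) :
    inner ℂ (ContinuousMap.toLp 2 μ ℂ (leftTranslate g f))
        (ContinuousMap.toLp 2 μ ℂ (leftTranslate g h)) =
      inner ℂ (ContinuousMap.toLp 2 μ ℂ f) (ContinuousMap.toLp 2 μ ℂ h) := by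
  simp only [ContinuousMap.inner_toLp, leftTranslate_apply]
  exact integral_mul_left_eq_self (fun x => h x * conj (f x)) g⁻¹

lemma inner_leftTranslate_left [IsFiniteMeasure μ] [μ.IsMulLeftInvariant] (g : G)
    (f h : C(G, ℂ)) :
    inner ℂ (ContinuousMap.toLp 2 μ ℂ (leftTranslate g f)) (ContinuousMap.toLp 2 μ ℂ h) =
      inner ℂ (ContinuousMap.toLp 2 μ ℂ f) (ContinuousMap.toLp 2 μ ℂ (leftTranslate g⁻¹ h)) := by
  rw [← inner_leftTranslate μ g⁻¹, ← leftTranslate_mul, inv_mul_cancel, leftTranslate_one]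

variable [IsFiniteMeasure μ]

/-- The convolution operator `(T_φ f)(x) = ∫ conj (φ (x⁻¹ z)) f(z) dz` from `L²` to continuous
functions. -/
noncomputable def convL2 (φ : C(G, ℂ)) : Lp ℂ 2 μ →L[ℂ] C(G, ℂ) :=
  LinearMap.mkContinuous
    { toFun := fun f =>
        { toFun := fun x => inner ℂ (ContinuousMap.toLp 2 μ ℂ (leftTranslate x φ)) f
          continuous_toFun :=
            (((ContinuousMap.toLp 2 μ ℂ).continuous.comp (continuous_leftTranslate φ)).inner
              continuous_const) }
      map_add' := fun f g => by ext x; simp [inner_add_right]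
      map_smul' := fun c f => by ext x; simp [inner_smul_right] }
    (‖(ContinuousMap.toLp 2 μ ℂ : C(G, ℂ) →L[ℂ] Lp ℂ 2 μ)‖ * ‖φ‖) fun f => by
      refine (ContinuousMap.norm_le _ (by positivity)).2 fun x => ?_
      refine (norm_inner_le_norm (𝕜 := ℂ) (ContinuousMap.toLp 2 μ ℂ (leftTranslate x φ)) f).trans ?_
      gcongr
      exact (ContinuousLinearMap.le_opNorm _ _).trans
        (by gcongr; exact norm_leftTranslate_le x φ)

lemma convL2_apply (φ : C(G, ℂ)) (f : Lp ℂ 2 μ) (x : G) :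
    convL2 μ φ f x = inner ℂ (ContinuousMap.toLp 2 μ ℂ (leftTranslate x φ)) f := rfl

lemma convL2_toLp (φ f : C(G, ℂ)) (x : G) :
    convL2 μ φ (ContinuousMap.toLp 2 μ ℂ f) x = ∫ z, f z * conj (φ (x⁻¹ * z)) ∂μ := by
  rw [convL2_apply, ContinuousMap.inner_toLp]; rfl

lemma convL2_toLp' [μ.IsMulLeftInvariant] (φ f : C(G, ℂ)) (x : G) :
    convL2 μ φ (ContinuousMap.toLp 2 μ ℂ f) x = ∫ z, f (x * z) * conj (φ z) ∂μ := by
  rw [convL2_toLp, ← integral_mul_left_eq_self _ x]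
  simp

/-- Left translations are unitary, so they can be moved across the inner product defining the
convolution. This makes the eigenspaces of `convL2Op` translation invariant. -/
lemma convL2_leftTranslate [μ.IsMulLeftInvariant] (φ f : C(G, ℂ)) (g : G) :
    convL2 μ φ (ContinuousMap.toLp 2 μ ℂ (leftTranslate g f)) =
      leftTranslate g (convL2 μ φ (ContinuousMap.toLp 2 μ ℂ f)) := by
  ext x
  rw [leftTranslate_apply, convL2_apply, convL2_apply,
    ← inner_leftTranslate μ g (leftTranslate (g⁻¹ * x) φ), ← leftTranslate_mul,
    mul_inv_cancel_left]

/-- The convolution operator on `L²`. -/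
noncomputable def convL2Op (φ : C(G, ℂ)) : Lp ℂ 2 μ →L[ℂ] Lp ℂ 2 μ :=
  (ContinuousMap.toLp 2 μ ℂ).comp (convL2 μ φ)

lemma convL2Op_apply (φ : C(G, ℂ)) (f : Lp ℂ 2 μ) :
    convL2Op μ φ f = ContinuousMap.toLp 2 μ ℂ (convL2 μ φ f) := rfl

/-- Arzelà–Ascoli: by Cauchy–Schwarz the images of the unit ball have common modulus of continuity
`‖λ_{x₀} φ - λ_x φ‖` at `x₀`, which tends to zero because translation is continuous. Compactness
into bounded continuous functions then passes to `L²`. -/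
lemma isCompactOperator_convL2Op (φ : C(G, ℂ)) : IsCompactOperator (convL2Op μ φ) := by
  let e := (ContinuousMap.linearIsometryBoundedOfCompact G ℂ ℂ)
  let S : Lp ℂ 2 μ →L[ℂ] BoundedContinuousFunction G ℂ :=
    (e.toContinuousLinearEquiv.toContinuousLinearMap).comp (convL2 μ φ)
  have hS : IsCompactOperator S := by
    refine (isCompactOperator_iff_isCompact_closure_image_closedBall
      (S : Lp ℂ 2 μ →ₗ[ℂ] BoundedContinuousFunction G ℂ) one_pos).2 ?_
    refine BoundedContinuousFunction.arzela_ascoli (Metric.closedBall 0 ‖S‖)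
      (isCompact_closedBall _ _) _ ?_ ?_
    · rintro _ x ⟨f, hf, rfl⟩
      rw [mem_closedBall_zero_iff] at hf ⊢
      exact ((S f).norm_coe_le_norm x).trans (S.unit_le_opNorm f hf)
    · intro x₀
      refine Metric.equicontinuousAt_of_continuity_modulus
        (fun x => ‖ContinuousMap.toLp 2 μ ℂ (leftTranslate x₀ φ) -
          ContinuousMap.toLp 2 μ ℂ (leftTranslate x φ)‖) ?_ _ ?_
      · have : Continuous fun x => ‖ContinuousMap.toLp 2 μ ℂ (leftTranslate x₀ φ) -
          ContinuousMap.toLp 2 μ ℂ (leftTranslate x φ)‖ :=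
          (continuous_const.sub ((ContinuousMap.toLp 2 μ ℂ).continuous.comp
            (continuous_leftTranslate φ))).norm
        simpa using this.tendsto x₀
      · refine Eventually.of_forall fun x => ?_
        rintro ⟨_, f, hf, rfl⟩
        rw [mem_closedBall_zero_iff] at hf
        change dist (convL2 μ φ f x₀) (convL2 μ φ f x) ≤ _
        rw [dist_eq_norm, convL2_apply, convL2_apply, ← inner_sub_left]
        exact (norm_inner_le_norm _ _).trans (mul_le_of_le_one_right (norm_nonneg _) hf)
  exact hS.clm_comp (BoundedContinuousFunction.toLp 2 μ ℂ)

/-- The condition on `φ` says that the kernel `conj (φ (x⁻¹ z))` is hermitian. Fubini gives symmetry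
on continuous functions, and density extends it to `L²`. -/
lemma isSymmetric_convL2Op [SecondCountableTopology G] [μ.WeaklyRegular] {φ : C(G, ℂ)}
    (hφ : ∀ u, φ u⁻¹ = conj (φ u)) : (convL2Op μ φ).IsSymmetric := by
  have hd := ContinuousMap.toLp_denseRange ℂ μ ℂ (p := 2) (by norm_num)
  have key : ∀ f h : C(G, ℂ),
      inner ℂ (convL2Op μ φ (ContinuousMap.toLp 2 μ ℂ f)) (ContinuousMap.toLp 2 μ ℂ h) =
      inner ℂ (ContinuousMap.toLp 2 μ ℂ f) (convL2Op μ φ (ContinuousMap.toLp 2 μ ℂ h)) := by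
    intro f h
    simp only [convL2Op_apply, ContinuousMap.inner_toLp, convL2_toLp, ← integral_conj,
      ← integral_const_mul, ← integral_mul_const]
    rw [integral_integral_swap]
    · refine integral_congr_ae (Eventually.of_forall fun x => integral_congr_ae
        (Eventually.of_forall fun y => ?_))
      have : φ (x⁻¹ * y) = conj (φ (y⁻¹ * x)) := by rw [← hφ]; simp
      simp only [this, map_mul, Complex.conj_conj]
      ring
    · have hc : Continuous (Function.uncurry fun x y : G =>
          h x * conj (f y * conj (φ (x⁻¹ * y)))) := by
        simp only [Function.uncurry_def]; fun_prop
      exact hc.integrable_of_hasCompactSupport (HasCompactSupport.of_compactSpace _)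
  intro f h
  refine hd.induction_on₂ (p := fun f h => inner ℂ (convL2Op μ φ f) h =
    inner ℂ f (convL2Op μ φ h)) ?_ key f h
  exact isClosed_eq (by fun_prop) (by fun_prop)

/-- An approximate identity: `φ` is a nonnegative even bump of integral one, supported where right
translation moves `h` by at most `ε` uniformly. -/
lemma exists_norm_convL2_sub_le [T2Space G] [μ.IsMulLeftInvariant] [μ.IsOpenPosMeasure]
    (h : C(G, ℂ)) {ε : ℝ} (hε : 0 < ε) :
    ∃ φ : C(G, ℂ), (∀ u, φ u⁻¹ = conj (φ u)) ∧
      ‖convL2 μ φ (ContinuousMap.toLp 2 μ ℂ h) - h‖ ≤ ε := by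
  obtain ⟨U, hU, hU1⟩ : ∃ U ∈ 𝓝 (1 : G), ∀ u ∈ U, ∀ x, ‖h (x * u) - h x‖ ≤ ε := by
    have hc : Continuous fun p : G × G => h (p.2 * p.1) := by fun_prop
    have hF := (ContinuousMap.curry ⟨_, hc⟩).continuous.tendsto 1
    refine ⟨_, hF (Metric.closedBall_mem_nhds _ hε), fun u hu x => ?_⟩
    have := (ContinuousMap.norm_coe_le_norm _ x).trans (mem_closedBall_iff_norm.1 hu)
    simpa using this
  have hV : interior U ∩ (interior U)⁻¹ ∈ 𝓝 (1 : G) :=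
    inter_mem (interior_mem_nhds.2 hU) (inv_mem_nhds_one G (interior_mem_nhds.2 hU))
  obtain ⟨ψ, hψ0, hψ1, hψ⟩ := exists_continuous_zero_one_of_isClosed
    (s := (interior U ∩ (interior U)⁻¹)ᶜ) (t := {(1 : G)})
    (isOpen_interior.inter isOpen_interior.inv).isClosed_compl isClosed_singleton
    (by rw [Set.disjoint_singleton_right]; exact fun h => h (mem_of_mem_nhds hV))
  -- Symmetrising makes the real bump satisfy the hermitian condition; both summands vanish off `U`
  -- because the Urysohn neighbourhood is symmetric.
  let ψ' : C(G, ℝ) := ψ + ψ.comp ⟨fun u => u⁻¹, continuous_inv⟩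
  have hψ'nn : ∀ u, 0 ≤ ψ' u := fun u => add_nonneg (hψ u).1 (hψ u⁻¹).1
  have hψ'inv : ∀ u, ψ' u⁻¹ = ψ' u := fun u => by simp [ψ', add_comm]
  have hψ'supp : ∀ u, u ∉ U → ψ' u = 0 := by
    intro u hu
    have h1 : ψ u = 0 := hψ0 (fun h => hu (interior_subset h.1))
    have h2 : ψ u⁻¹ = 0 := hψ0 (fun h => hu (interior_subset (by simpa using h.2)))
    simp [ψ', h1, h2]
  have hint : ∀ f : C(G, ℂ), Integrable f μ := fun f =>
    f.continuous.integrable_of_hasCompactSupport (HasCompactSupport.of_compactSpace _)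
  have hintR : ∀ f : C(G, ℝ), Integrable f μ := fun f =>
    f.continuous.integrable_of_hasCompactSupport (HasCompactSupport.of_compactSpace _)
  set c := ∫ u, ψ' u ∂μ with hc
  have hcpos : 0 < c := by
    refine ψ'.continuous.integral_pos_of_hasCompactSupport_nonneg_nonzero
      (HasCompactSupport.of_compactSpace _) hψ'nn (x := 1) ?_
    have : ψ 1 = 1 := hψ1 rfl
    simp [ψ', this]
  refine ⟨⟨fun u => ((ψ' u / c : ℝ) : ℂ), by fun_prop⟩, fun u => by simp [hψ'inv], ?_⟩
  refine (ContinuousMap.norm_le _ hε.le).2 fun x => ?_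
  have e1 : convL2 μ ⟨fun u => ((ψ' u / c : ℝ) : ℂ), by fun_prop⟩
      (ContinuousMap.toLp 2 μ ℂ h) x - h x =
      ∫ z, (h (x * z) - h x) * ((ψ' z / c : ℝ) : ℂ) ∂μ := by
    have e2 : h x = ∫ z, h x * ((ψ' z / c : ℝ) : ℂ) ∂μ := by
      rw [integral_const_mul, integral_complex_ofReal, integral_div, ← hc, div_self hcpos.ne']
      simp
    rw [convL2_toLp']
    conv_lhs => rw [e2]
    rw [← integral_sub]
    · simp only [ContinuousMap.coe_mk, Complex.conj_ofReal, sub_mul]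
    · exact hint ⟨fun z => h (x * z) * conj ((ψ' z / c : ℝ) : ℂ), by fun_prop⟩
    · exact hint ⟨fun z => h x * ((ψ' z / c : ℝ) : ℂ), by fun_prop⟩
  rw [ContinuousMap.sub_apply, e1]
  calc ‖∫ z, (h (x * z) - h x) * ((ψ' z / c : ℝ) : ℂ) ∂μ‖
      ≤ ∫ z, ε * (ψ' z / c) ∂μ := by
        refine norm_integral_le_of_norm_le ?_ (Eventually.of_forall fun z => ?_)
        · exact hintR ⟨fun z => ε * (ψ' z / c), by fun_prop⟩
        · rw [norm_mul, Complex.norm_real, Real.norm_of_nonneg (div_nonneg (hψ'nn z) hcpos.le)]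
          by_cases hz : z ∈ U
          · exact mul_le_mul_of_nonneg_right (hU1 z hz x) (div_nonneg (hψ'nn z) hcpos.le)
          · simp [hψ'supp z hz]
    _ = ε := by
        rw [integral_const_mul, integral_div, ← hc, div_self hcpos.ne', mul_one]

end Convolution

/-! ### Finite-dimensional translation-invariant spaces consist of matrix coefficients -/

section RepresentativeFunctions

namespace IrrepMatrix

variable {G : Type*} [Group G] [TopologicalSpace G] (ξ : IrrepMatrix G)

lemma coeff_apply (i j : Fin ξ.dim) (x : G) : ξ.coeff i j x = ξ.mat x i j := rfl

lemma mat_mul (x y : G) : ξ.mat (x * y) = ξ.mat x * ξ.mat y := by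
  simp [mat]

lemma mat_inv (x : G) : ξ.mat x⁻¹ = (ξ.mat x)ᴴ := by
  simp [mat, Matrix.star_eq_conjTranspose]

lemma conjTranspose_mul_mat (x : G) : (ξ.mat x)ᴴ * ξ.mat x = 1 :=
  Matrix.mem_unitaryGroup_iff'.1 (ξ.rep x).2

lemma mat_mul_conjTranspose (x : G) : ξ.mat x * (ξ.mat x)ᴴ = 1 :=
  Matrix.mem_unitaryGroup_iff.1 (ξ.rep x).2

lemma coeff_mul (i j : Fin ξ.dim) (x y : G) :
    ξ.coeff i j (x * y) = ∑ k, ξ.coeff i k x * ξ.coeff k j y := by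
  simp only [coeff_apply, mat_mul, Matrix.mul_apply]

lemma coeff_inv (i j : Fin ξ.dim) (x : G) :
    ξ.coeff i j x⁻¹ = conj (ξ.coeff j i x) := by
  simp only [coeff_apply, mat_inv, Matrix.conjTranspose_apply, Complex.star_def]

end IrrepMatrix

/-- The span of the matrix coefficients of the irreducible unitary representations. -/
noncomputable def matrixCoeffSpan (G : Type*) [Group G] [TopologicalSpace G] : Submodule ℂ C(G, ℂ) :=
  Submodule.span ℂ {f | ∃ (ξ : IrrepMatrix G) (i j : Fin ξ.dim), f = ξ.coeff i j}

lemma coeff_mem_matrixCoeffSpan {G : Type*} [Group G] [TopologicalSpace G] (ξ : IrrepMatrix G)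
    (i j : Fin ξ.dim) : ξ.coeff i j ∈ matrixCoeffSpan G :=
  Submodule.subset_span ⟨ξ, i, j, rfl⟩

variable {G : Type*} [TopologicalSpace G] [Group G] [IsTopologicalGroup G]
  [CompactSpace G] [MeasurableSpace G] [BorelSpace G]
  (μ : Measure G) [IsFiniteMeasure μ]

lemma ContinuousMap.integrable_of_compactSpace (f : C(G, ℂ)) : Integrable f μ :=
  f.continuous.integrable_of_hasCompactSupport (HasCompactSupport.of_compactSpace _)

/-- From `ξ_ij(xz) = ∑ ξ_ik(x) ξ_kj(z)`, convolution sends `ξ_ij` to a combination of the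
coefficients `ξ_ik` in the same row. -/
lemma convL2_mem_matrixCoeffSpan [μ.IsMulLeftInvariant] (φ : C(G, ℂ)) {f : C(G, ℂ)}
    (hf : f ∈ matrixCoeffSpan G) :
    convL2 μ φ (ContinuousMap.toLp 2 μ ℂ f) ∈ matrixCoeffSpan G := by
  have : matrixCoeffSpan G ≤ (matrixCoeffSpan G).comap
      ((convL2 μ φ).comp (ContinuousMap.toLp 2 μ ℂ) : C(G, ℂ) →ₗ[ℂ] C(G, ℂ)) := by
    refine Submodule.span_le.2 ?_
    rintro _ ⟨ξ, i, j, rfl⟩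
    have e : convL2 μ φ (ContinuousMap.toLp 2 μ ℂ (ξ.coeff i j)) =
        ∑ k, (∫ z, ξ.coeff k j z * conj (φ z) ∂μ) • ξ.coeff i k := by
      ext x
      simp only [convL2_toLp', ξ.coeff_mul, Finset.sum_mul, ContinuousMap.sum_apply,
        ContinuousMap.smul_apply, smul_eq_mul]
      rw [integral_finsetSum]
      · refine Finset.sum_congr rfl fun k _ => ?_
        rw [← integral_mul_const]
        congr 1; ext z; ring
      · intro k _
        exact ContinuousMap.integrable_of_compactSpace μ
          ⟨fun z => ξ.coeff i k x * ξ.coeff k j z * conj (φ z), by fun_prop⟩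
    change convL2 μ φ (ContinuousMap.toLp 2 μ ℂ (ξ.coeff i j)) ∈ matrixCoeffSpan G
    rw [e]
    exact Submodule.sum_mem _ fun k _ =>
      Submodule.smul_mem _ _ (coeff_mem_matrixCoeffSpan ξ i k)
  exact this hf

/-- A subspace of `L²`, consisting of continuous functions, that is invariant under left
translations. -/
structure IsTranslationInvariant (K : Submodule ℂ (Lp ℂ 2 μ)) : Prop where
  le_range : ∀ f ∈ K, ∃ h : C(G, ℂ), ContinuousMap.toLp 2 μ ℂ h = f
  translate_mem : ∀ (g : G) (h : C(G, ℂ)), ContinuousMap.toLp 2 μ ℂ h ∈ K →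
    ContinuousMap.toLp 2 μ ℂ (leftTranslate g h) ∈ K

lemma IsTranslationInvariant.orthogonal_inf [μ.IsMulLeftInvariant]
    {K W : Submodule ℂ (Lp ℂ 2 μ)}
    (hK : IsTranslationInvariant μ K) (hW : IsTranslationInvariant μ W) :
    IsTranslationInvariant μ (Wᗮ ⊓ K) where
  le_range f hf := hK.le_range f hf.2
  translate_mem g h hh := by
    refine ⟨fun w hw => ?_, hK.translate_mem g h hh.2⟩
    obtain ⟨w, rfl⟩ := hW.le_range w hw
    have := inner_leftTranslate_left μ g⁻¹ w h
    rw [inv_inv] at this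
    rw [← this]
    exact hh.1 _ (hW.translate_mem _ _ hw)

/-- An irreducible finite-dimensional translation-invariant subspace is spanned by matrix
coefficients. -/
lemma IsTranslationInvariant.le_map_of_irreducible [μ.IsMulLeftInvariant] [μ.IsOpenPosMeasure]
    {K : Submodule ℂ (Lp ℂ 2 μ)} [FiniteDimensional ℂ K] (hK : IsTranslationInvariant μ K)
    (hK0 : K ≠ ⊥)
    (hirr : ∀ W ≤ K, IsTranslationInvariant μ W → W = ⊥ ∨ W = K) :
    K ≤ (matrixCoeffSpan G).map (ContinuousMap.toLp (E := ℂ) 2 μ ℂ).toLinearMap := by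
  let b := stdOrthonormalBasis ℂ K
  choose e he using fun i => hK.le_range (b i) (b i).2
  let ι : C(G, ℂ) →L[ℂ] Lp ℂ 2 μ := ContinuousMap.toLp 2 μ ℂ
  have hι : Function.Injective ι := ContinuousMap.toLp_injective μ
  have hon : ∀ i j, inner ℂ (ι (e i)) (ι (e j)) = if i = j then (1 : ℂ) else 0 := fun i j => by
    rw [show ι (e i) = _ from he i, show ι (e j) = _ from he j]
    exact orthonormal_iff_ite.1 b.orthonormal i j
  -- coordinates of the elements of `K`
  have hexp : ∀ h : C(G, ℂ), ι h ∈ K → h = ∑ i, inner ℂ (ι (e i)) (ι h) • e i := by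
    intro h hh
    apply hι
    have := congrArg Subtype.val (b.sum_repr' ⟨ι h, hh⟩)
    rw [map_sum]
    simp only [Submodule.coe_sum, Submodule.coe_smul, Submodule.coe_inner] at this
    refine this.symm.trans (Finset.sum_congr rfl fun i _ => ?_)
    rw [map_smul, show ι (e i) = _ from he i]
  have heK : ∀ i, ι (e i) ∈ K := fun i => by
    rw [show ι (e i) = _ from he i]; exact (b i).2
  -- This is the entrywise conjugate of the usual matrix of the translation by `g`. With this choice
  -- the basis functions are combinations of coefficients of `R` itself, not of its conjugate.
  let R : G → Matrix (Fin (Module.finrank ℂ K)) (Fin (Module.finrank ℂ K)) ℂ := fun g =>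
    Matrix.of fun i j => inner ℂ (ι (leftTranslate g (e j))) (ι (e i))
  have hRexp : ∀ g j, leftTranslate g (e j) = ∑ i, conj (R g i j) • e i := fun g j => by
    have := hexp _ (hK.translate_mem g (e j) (heK j))
    simpa only [R, Matrix.of_apply, inner_conj_symm] using this
  have hR1 : R 1 = 1 := by
    ext i j
    simp only [R, Matrix.of_apply, leftTranslate_one, hon, Matrix.one_apply, eq_comm]
  have hRmul : ∀ g h, R (g * h) = R g * R h := fun g h => by
    ext i j
    simp only [R, Matrix.of_apply, leftTranslate_mul, Matrix.mul_apply]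
    conv_lhs => rw [hRexp h j]
    simp only [map_sum, map_smul, sum_inner, inner_smul_left, Complex.conj_conj]
    exact Finset.sum_congr rfl fun k _ => mul_comm _ _
  have hRunit : ∀ g, R g ∈ Matrix.unitaryGroup (Fin (Module.finrank ℂ K)) ℂ := fun g => by
    rw [Matrix.mem_unitaryGroup_iff']
    ext i j
    have h1 := inner_leftTranslate μ g (e j) (e i)
    change _ = inner ℂ (ι (e j)) (ι (e i)) at h1
    rw [hon, hRexp g i, hRexp g j] at h1
    change inner ℂ (ι _) (ι _) = _ at h1
    simp only [map_sum, map_smul, sum_inner, inner_sum, inner_smul_left, inner_smul_right, hon,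
      Complex.conj_conj] at h1
    simp only [mul_ite, mul_one, mul_zero, Finset.sum_ite_eq', Finset.mem_univ, if_true] at h1
    rw [Matrix.mul_apply, Matrix.one_apply]
    simp only [Matrix.star_apply, Complex.star_def, eq_comm (a := i)]
    rw [← h1]
  let ξ : IrrepMatrix G :=
    { dim := Module.finrank ℂ K
      rep := { toFun := fun g => ⟨R g, hRunit g⟩
               map_one' := Subtype.ext hR1
               map_mul' := fun g h => Subtype.ext (hRmul g h) }
      continuous_rep := by
        refine Continuous.subtype_mk (continuous_matrix fun i j => ?_) _
        exact ((ι.continuous.comp (continuous_leftTranslate (e j))).inner continuous_const)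
      dim_pos := by
        rw [Module.finrank_pos_iff]
        exact Submodule.nontrivial_iff_ne_bot.2 hK0
      irreducible := by
        intro W hW
        -- These coordinates are conjugate-linear and intertwine translation with `R`. The preimage
        -- of `W` is still a complex subspace, so irreducibility of `K` transfers to `R`.
        let c : Lp ℂ 2 μ → (Fin (Module.finrank ℂ K) → ℂ) := fun k i => inner ℂ k (ι (e i))
        let W' : Submodule ℂ (Lp ℂ 2 μ) :=
          { carrier := {k | k ∈ K ∧ c k ∈ W}
            zero_mem' := ⟨K.zero_mem, by
              have : c 0 = 0 := by ext i; simp [c]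
              rw [this]; exact W.zero_mem⟩
            add_mem' := by
              rintro x y ⟨hx, hx'⟩ ⟨hy, hy'⟩
              refine ⟨K.add_mem hx hy, ?_⟩
              have : c (x + y) = c x + c y := by ext i; simp [c, inner_add_left]
              rw [this]; exact W.add_mem hx' hy'
            smul_mem' := by
              rintro a x ⟨hx, hx'⟩
              refine ⟨K.smul_mem a hx, ?_⟩
              have : c (a • x) = conj a • c x := by ext i; simp [c, inner_smul_left]
              rw [this]; exact W.smul_mem _ hx' }
        have hc : ∀ v, c (∑ i, conj (v i) • ι (e i)) = v := fun v => by
          ext j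
          simp [c, sum_inner, inner_smul_left, hon]
        have hcK : ∀ v : Fin (Module.finrank ℂ K) → ℂ, (∑ i, conj (v i) • ι (e i)) ∈ K := fun v =>
          Submodule.sum_mem _ fun i _ => Submodule.smul_mem _ _ (heK i)
        have hW'inv : IsTranslationInvariant μ W' :=
          { le_range := fun f hf => hK.le_range f hf.1
            translate_mem := by
              rintro g h ⟨hhK, hhW⟩
              refine ⟨hK.translate_mem g h hhK, ?_⟩
              have : c (ι (leftTranslate g h)) = R g *ᵥ c (ι h) := by
                ext i
                conv_lhs => rw [hexp h hhK]
                simp only [c, map_sum, map_smul, sum_inner, inner_smul_left, inner_conj_symm,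
                  Matrix.mulVec, dotProduct, R, Matrix.of_apply]
                exact Finset.sum_congr rfl fun k _ => mul_comm _ _
              change c (ι (leftTranslate g h)) ∈ W
              rw [this]
              exact hW g _ hhW }
        rcases hirr W' (fun x hx => hx.1) hW'inv with h | h
        · left
          rw [eq_bot_iff]
          intro v hv
          have hmem : (∑ i, conj (v i) • ι (e i)) ∈ W' := ⟨hcK v, by rw [hc]; exact hv⟩
          rw [h, Submodule.mem_bot] at hmem
          have := hc v
          rw [hmem] at this
          rw [Submodule.mem_bot, ← this]
          ext i; simp [c]
        · right
          rw [eq_top_iff]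
          intro v _
          have hmem := (h.ge (hcK v)).2
          rwa [hc v] at hmem }
  have hmem : ∀ j, e j ∈ matrixCoeffSpan G := fun j => by
    -- Evaluate the expansion of `λ_{g⁻¹} e_j` at the identity, then use unitarity to turn `conj (R
    -- g⁻¹ i j)` into `R g j i`.
    have : e j = ∑ i, (e i 1) • ξ.coeff j i := by
      ext g
      have h1 := DFunLike.congr_fun (hRexp g⁻¹ j) 1
      simp only [leftTranslate_apply, inv_inv, mul_one, ContinuousMap.sum_apply,
        ContinuousMap.smul_apply, smul_eq_mul] at h1
      simp only [ContinuousMap.sum_apply, ContinuousMap.smul_apply, smul_eq_mul]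
      rw [h1]
      refine Finset.sum_congr rfl fun i _ => ?_
      have h2 := ξ.coeff_inv i j g
      change R g⁻¹ i j = _ at h2
      rw [h2, Complex.conj_conj, mul_comm]
    rw [this]
    exact Submodule.sum_mem _ fun i _ =>
      Submodule.smul_mem _ _ (coeff_mem_matrixCoeffSpan ξ j i)
  intro f hf
  obtain ⟨h, rfl⟩ := hK.le_range f hf
  refine ⟨h, ?_, rfl⟩
  rw [hexp h hf]
  exact Submodule.sum_mem _ fun i _ => Submodule.smul_mem _ _ (hmem i)

/-- Complete reducibility by strong induction on dimension: a reducible `K` is the sum of a proper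
invariant `W` and its invariant orthogonal complement in `K`. -/
lemma IsTranslationInvariant.le_map_matrixCoeffSpan [μ.IsMulLeftInvariant] [μ.IsOpenPosMeasure]
    {K : Submodule ℂ (Lp ℂ 2 μ)} [FiniteDimensional ℂ K] (hK : IsTranslationInvariant μ K) :
    K ≤ (matrixCoeffSpan G).map (ContinuousMap.toLp (E := ℂ) 2 μ ℂ).toLinearMap := by
  induction hn : Module.finrank ℂ K using Nat.strong_induction_on generalizing K with
  | _ n ih =>
    by_cases hK0 : K = ⊥
    · rw [hK0]; exact bot_le
    by_cases hirr : ∀ W ≤ K, IsTranslationInvariant μ W → W = ⊥ ∨ W = K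
    · exact hK.le_map_of_irreducible μ hK0 hirr
    push Not at hirr
    obtain ⟨W, hWK, hW, hW0, hWne⟩ := hirr
    have : FiniteDimensional ℂ W := Submodule.finiteDimensional_of_le hWK
    have : FiniteDimensional ℂ (Wᗮ ⊓ K : Submodule ℂ (Lp ℂ 2 μ)) :=
      Submodule.finiteDimensional_of_le inf_le_right
    have hne : Wᗮ ⊓ K ≠ K := by
      intro h
      apply hW0
      rw [eq_bot_iff]
      intro w hw
      have h1 : w ∈ Wᗮ := (inf_eq_right.1 h) (hWK hw)
      exact (Submodule.mem_bot ℂ).2 (inner_self_eq_zero.1 (h1 w hw))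
    rw [← Submodule.sup_orthogonal_inf_of_hasOrthogonalProjection hWK]
    refine sup_le (ih _ ?_ hW rfl) (ih _ ?_ (hK.orthogonal_inf μ hW) rfl)
    · rw [← hn]; exact Submodule.finrank_lt_finrank_of_lt (lt_of_le_of_ne hWK hWne)
    · rw [← hn]; exact Submodule.finrank_lt_finrank_of_lt (lt_of_le_of_ne inf_le_right hne)

end RepresentativeFunctions

/-! ### The Peter–Weyl theorem -/

section PeterWeyl

variable {G : Type*} [TopologicalSpace G] [Group G] [IsTopologicalGroup G]
  [CompactSpace G] [MeasurableSpace G] [BorelSpace G]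
  (μ : Measure G) [IsFiniteMeasure μ] [μ.IsMulLeftInvariant] [μ.IsOpenPosMeasure]

/-- For `c ≠ 0` an eigenvector equals `c⁻¹` times its own convolution, hence has a continuous
representative. -/
lemma isTranslationInvariant_eigenspace (φ : C(G, ℂ)) {c : ℂ} (hc : c ≠ 0) :
    IsTranslationInvariant μ
      (Module.End.eigenspace (convL2Op μ φ).toLinearMap c) where
  le_range f hf := by
    rw [Module.End.mem_eigenspace_iff] at hf
    refine ⟨c⁻¹ • convL2 μ φ f, ?_⟩
    rw [map_smul, inv_smul_eq_iff₀ hc]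
    exact hf
  translate_mem g h hh := by
    rw [Module.End.mem_eigenspace_iff] at hh ⊢
    have h1 : convL2 μ φ (ContinuousMap.toLp 2 μ ℂ h) = c • h := by
      apply ContinuousMap.toLp_injective (p := 2) (𝕜 := ℂ) μ
      rw [map_smul]
      exact hh
    change ContinuousMap.toLp 2 μ ℂ (convL2 μ φ _) = _
    rw [convL2_leftTranslate, h1, map_smul, map_smul]

lemma eigenspace_convL2Op_le (φ : C(G, ℂ)) {c : ℂ} (hc : c ≠ 0) :
    Module.End.eigenspace (convL2Op μ φ).toLinearMap c ≤
      (matrixCoeffSpan G).map (ContinuousMap.toLp (E := ℂ) 2 μ ℂ).toLinearMap := by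
  have := ContinuousLinearMap.finite_dimensional_eigenspace
    (isCompactOperator_convL2Op μ φ) c hc
  exact (isTranslationInvariant_eigenspace μ φ hc).le_map_matrixCoeffSpan μ

variable [T2Space G] [SecondCountableTopology G] [μ.WeaklyRegular]

/-- By symmetry the image of `f` pairs with a `c`-eigenvector `e` to `conj c * ⟨e, f⟩`. This
vanishes trivially for `c = 0`, and otherwise because `e` lies in the coefficient span. The spectral
theorem for compact self-adjoint operators then leaves only zero. -/
lemma convL2Op_eq_zero_of_mem_orthogonal {φ : C(G, ℂ)} (hφ : ∀ u, φ u⁻¹ = conj (φ u))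
    {f : Lp ℂ 2 μ}
    (hf : f ∈ ((matrixCoeffSpan G).map (ContinuousMap.toLp (E := ℂ) 2 μ ℂ).toLinearMap)ᗮ) :
    convL2Op μ φ f = 0 := by
  have hsymm := isSymmetric_convL2Op μ hφ
  have hmem : convL2Op μ φ f ∈
      (⨆ c, Module.End.eigenspace (convL2Op μ φ : Module.End ℂ (Lp ℂ 2 μ)) c)ᗮ := by
    rw [← Submodule.iInf_orthogonal]
    refine (Submodule.mem_iInf _).2 fun c e he => ?_
    have he' := Module.End.mem_eigenspace_iff.1 he
    have h1 : inner ℂ e (convL2Op μ φ f) = inner ℂ (c • e) f := by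
      rw [← he']; exact (hsymm e f).symm
    rw [h1, inner_smul_left]
    by_cases hc : c = 0
    · simp [hc]
    · rw [hf e (eigenspace_convL2Op_le μ φ hc he), mul_zero]
  rw [ContinuousLinearMap.orthogonalComplement_iSup_eigenspaces_eq_bot
    (isCompactOperator_convL2Op μ φ) hsymm] at hmem
  exact (Submodule.mem_bot ℂ).1 hmem

/-- **Peter–Weyl theorem** in `L²`. -/
theorem topologicalClosure_matrixCoeffSpan_L2 :
    ((matrixCoeffSpan G).map
      (ContinuousMap.toLp (E := ℂ) 2 μ ℂ).toLinearMap).topologicalClosure = ⊤ := by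
  rw [Submodule.topologicalClosure_eq_top_iff, eq_bot_iff]
  intro f hf
  have key : ∀ h : C(G, ℂ), inner ℂ f (ContinuousMap.toLp 2 μ ℂ h) = 0 := by
    intro h
    let ι : C(G, ℂ) →L[ℂ] Lp ℂ 2 μ := ContinuousMap.toLp 2 μ ℂ
    rw [← norm_le_zero_iff]
    refine le_of_forall_pos_le_add fun ε hε => ?_
    -- The `+ 1` in the denominator keeps the tolerance meaningful when `‖f‖ * ‖ι‖ = 0`.
    obtain ⟨φ, hφ, hle⟩ := exists_norm_convL2_sub_le μ h
      (ε := ε / (‖f‖ * ‖ι‖ + 1)) (by positivity)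
    have h0 : inner ℂ f (convL2Op μ φ (ι h)) = 0 := by
      have := isSymmetric_convL2Op μ hφ f (ι h)
      refine this.symm.trans ?_
      change inner ℂ (convL2Op μ φ f) (ι h) = 0
      rw [convL2Op_eq_zero_of_mem_orthogonal μ hφ hf, inner_zero_left]
    have h1 : inner ℂ f (ι h) = - inner ℂ f (ι (convL2 μ φ (ι h) - h)) := by
      rw [map_sub, inner_sub_right]
      change _ = -(inner ℂ f (convL2Op μ φ (ι h)) - _)
      rw [h0]; ring
    change ‖inner ℂ f (ι h)‖ ≤ 0 + ε
    rw [h1, norm_neg, zero_add]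
    calc ‖inner ℂ f (ι (convL2 μ φ (ι h) - h))‖
        ≤ ‖f‖ * (‖ι‖ * (ε / (‖f‖ * ‖ι‖ + 1))) := by
          refine (norm_inner_le_norm _ _).trans ?_
          gcongr
          exact (ι.le_opNorm _).trans (by gcongr)
      _ = ‖f‖ * ‖ι‖ / (‖f‖ * ‖ι‖ + 1) * ε := by ring
      _ ≤ 1 * ε := by
          gcongr
          rw [div_le_one (by positivity)]
          linarith
      _ = ε := one_mul ε
  have hd := ContinuousMap.toLp_denseRange ℂ μ ℂ (p := 2) (by norm_num)
  have : inner ℂ f f = 0 := by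
    refine hd.induction_on (p := fun h => inner ℂ f h = 0) f ?_ key
    exact isClosed_eq (by fun_prop) (by fun_prop)
  exact (Submodule.mem_bot ℂ).2 (inner_self_eq_zero.1 this)

/-- **Peter–Weyl theorem**: matrix coefficients are uniformly dense in the continuous functions. -/
theorem dense_matrixCoeffSpan (μ : Measure G) [IsFiniteMeasure μ] [μ.IsMulLeftInvariant]
    [μ.IsOpenPosMeasure] [μ.WeaklyRegular] : Dense (matrixCoeffSpan G : Set C(G, ℂ)) := by
  intro h
  refine Metric.mem_closure_iff.2 fun ε hε => ?_
  obtain ⟨φ, -, hle⟩ := exists_norm_convL2_sub_le μ h (ε := ε / 2) (by positivity)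
  -- Convolution is continuous from `L²` to the sup norm and preserves the coefficient span, so it
  -- turns `L²` approximation of `h` into uniform approximation of its convolution.
  have hmem : convL2 μ φ (ContinuousMap.toLp 2 μ ℂ h) ∈
      closure (matrixCoeffSpan G : Set C(G, ℂ)) := by
    refine map_mem_closure (convL2 μ φ).continuous (s := ((matrixCoeffSpan G).map
      (ContinuousMap.toLp (E := ℂ) 2 μ ℂ).toLinearMap : Set (Lp ℂ 2 μ))) ?_ ?_
    · rw [← Submodule.topologicalClosure_coe, topologicalClosure_matrixCoeffSpan_L2 μ]
      trivial
    · rintro _ ⟨f, hf, rfl⟩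
      exact convL2_mem_matrixCoeffSpan μ φ hf
  obtain ⟨m, hm, hlt⟩ := Metric.mem_closure_iff.1 hmem (ε / 2) (by positivity)
  refine ⟨m, hm, ?_⟩
  rw [← dist_eq_norm, dist_comm] at hle
  linarith [dist_triangle h (convL2 μ φ (ContinuousMap.toLp 2 μ ℂ h)) m]

/-- **Peter–Weyl theorem** in `Lᵖ`, `p < ∞`. -/
theorem dense_map_matrixCoeffSpan {p : ℝ≥0∞} [Fact (1 ≤ p)] (hp : p ≠ ⊤) :
    Dense (ContinuousMap.toLp p μ ℂ '' (matrixCoeffSpan G : Set C(G, ℂ))) :=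
  (ContinuousMap.toLp_denseRange ℂ μ ℂ hp).dense_image (ContinuousMap.toLp p μ ℂ).continuous
    (dense_matrixCoeffSpan μ)

end PeterWeyl

/-! ### Independence of the choice of representatives -/

section UnitaryDual

variable {G : Type*} [Group G] [TopologicalSpace G]

/-- The matrix coefficients of a choice of representatives span those of all representations. -/
lemma matrixCoeffSpan_le_span_of_representatives (ξ : UnitaryDual G → IrrepMatrix G)
    (hξ : ∀ π, UnitaryDual.mk (ξ π) = π) :
    matrixCoeffSpan G ≤ Submodule.span ℂ
      {f | ∃ (π : UnitaryDual G) (i j : Fin (ξ π).dim), f = (ξ π).coeff i j} := by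
  refine Submodule.span_le.2 ?_
  rintro _ ⟨η, i, j, rfl⟩
  obtain ⟨U, h1, h2, h⟩ : IrrepMatrix.Equivalent (ξ (UnitaryDual.mk η)) η :=
    Quotient.exact (hξ (UnitaryDual.mk η))
  have e : η.coeff i j = ∑ l, ∑ k, (star (U k i) * U l j) •
      (ξ (UnitaryDual.mk η)).coeff k l := by
    ext x
    have hx : η.mat x = Uᴴ * (ξ (UnitaryDual.mk η)).mat x * U := by
      rw [Matrix.mul_assoc, h, ← Matrix.mul_assoc, h2, Matrix.one_mul]
    simp only [ContinuousMap.sum_apply, ContinuousMap.smul_apply, smul_eq_mul,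
      IrrepMatrix.coeff_apply]
    rw [hx]
    simp only [Matrix.mul_apply, Matrix.conjTranspose_apply, Finset.sum_mul]
    exact Finset.sum_congr rfl fun l _ => Finset.sum_congr rfl fun k _ => by ring
  rw [e]
  exact Submodule.sum_mem _ fun l _ => Submodule.sum_mem _ fun k _ =>
    Submodule.smul_mem _ _ (Submodule.subset_span ⟨_, k, l, rfl⟩)

end UnitaryDual

/-! ### Schur's lemma, orthogonality relations and norms of matrix coefficients -/

section Schur

namespace IrrepMatrix

variable {G : Type*} [Group G] [TopologicalSpace G]

/-- **Schur's lemma**: a matrix commuting with an irreducible representation is scalar. -/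
lemma exists_eq_smul_one_of_commute (ξ : IrrepMatrix G)
    {S : Matrix (Fin ξ.dim) (Fin ξ.dim) ℂ} (hS : ∀ x, ξ.mat x * S = S * ξ.mat x) :
    ∃ c : ℂ, S = c • 1 := by
  have : Nonempty (Fin ξ.dim) := ⟨⟨0, ξ.dim_pos⟩⟩
  obtain ⟨c, hc⟩ := Module.End.exists_eigenvalue (Matrix.toLin' S)
  refine ⟨c, ?_⟩
  rcases ξ.irreducible (Module.End.eigenspace (Matrix.toLin' S) c) (fun g v hv => by
    rw [Module.End.mem_eigenspace_iff, Matrix.toLin'_apply] at hv ⊢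
    change S *ᵥ (ξ.mat g *ᵥ v) = c • (ξ.mat g *ᵥ v)
    rw [Matrix.mulVec_mulVec, ← hS, ← Matrix.mulVec_mulVec, hv, Matrix.mulVec_smul]) with h | h
  · exact absurd h hc
  · apply Matrix.toLin'.injective
    refine LinearMap.ext fun v => ?_
    have hv : v ∈ Module.End.eigenspace (Matrix.toLin' S) c := h ▸ Submodule.mem_top
    simpa using Module.End.mem_eigenspace_iff.1 hv

/-- **Schur's lemma**: a nonzero intertwining matrix exists only for equivalent representations. -/
lemma equivalent_of_intertwining (ξ η : IrrepMatrix G)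
    {T : Matrix (Fin ξ.dim) (Fin η.dim) ℂ} (hT0 : T ≠ 0)
    (hT : ∀ x, ξ.mat x * T = T * η.mat x) : Equivalent ξ η := by
  have hT' : ∀ x, η.mat x * Tᴴ = Tᴴ * ξ.mat x := fun x => by
    have h := congrArg Matrix.conjTranspose (hT x⁻¹)
    rw [Matrix.conjTranspose_mul, Matrix.conjTranspose_mul, mat_inv, mat_inv,
      Matrix.conjTranspose_conjTranspose, Matrix.conjTranspose_conjTranspose] at h
    exact h.symm
  obtain ⟨c, hc⟩ := η.exists_eq_smul_one_of_commute (S := Tᴴ * T) fun x => by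
    rw [← Matrix.mul_assoc, hT', Matrix.mul_assoc, hT, Matrix.mul_assoc]
  -- Both products are needed: the two dimensions are not known to agree, so unitarity must be
  -- checked on each side.
  obtain ⟨c', hc'⟩ := ξ.exists_eq_smul_one_of_commute (S := T * Tᴴ) fun x => by
    rw [← Matrix.mul_assoc, hT, Matrix.mul_assoc, hT', Matrix.mul_assoc]
  have hcc : c' = c := by
    have h1 : c • T = c' • T := by
      calc c • T = T * (Tᴴ * T) := by rw [hc]; simp
        _ = c' • T := by rw [← Matrix.mul_assoc, hc']; simp
    by_contra hne
    exact hT0 ((smul_eq_zero.1 (show (c' - c) • T = 0 by rw [sub_smul, h1, sub_self])).resolve_left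
      (sub_ne_zero.2 hne))
  obtain ⟨i₀, j, hij⟩ : ∃ i j, T i j ≠ 0 := by
    by_contra! h
    exact hT0 (Matrix.ext h)
  -- The scalar is the squared length of a nonzero column of `T`, hence positive, and dividing `T`
  -- by its square root gives a unitary.
  have hcj : c = ((∑ i, ‖T i j‖ ^ 2 : ℝ) : ℂ) := by
    have h1 := congrFun (congrFun hc j) j
    simp only [Matrix.mul_apply, Matrix.conjTranspose_apply, Matrix.smul_apply,
      Matrix.one_apply_eq, smul_eq_mul, mul_one] at h1
    rw [← h1]
    push_cast
    exact Finset.sum_congr rfl fun i _ => Complex.conj_mul' _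
  set t : ℝ := ∑ i, ‖T i j‖ ^ 2 with ht
  have htpos : 0 < t := Finset.sum_pos' (fun i _ => by positivity)
    ⟨i₀, Finset.mem_univ _, by have := norm_pos_iff.2 hij; positivity⟩
  have hs : ((Real.sqrt t : ℂ))⁻¹ * ((Real.sqrt t : ℂ))⁻¹ * c = 1 := by
    rw [hcj, ← mul_inv, ← Complex.ofReal_mul, Real.mul_self_sqrt htpos.le]
    exact inv_mul_cancel₀ (by exact_mod_cast htpos.ne')
  have hstar : (((Real.sqrt t : ℂ))⁻¹ • T)ᴴ = ((Real.sqrt t : ℂ))⁻¹ • Tᴴ := by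
    rw [Matrix.conjTranspose_smul]
    congr 1
    rw [Complex.star_def, map_inv₀, Complex.conj_ofReal]
  refine ⟨((Real.sqrt t : ℂ))⁻¹ • T, ?_, ?_, fun x => ?_⟩
  · rw [hstar, Matrix.smul_mul, Matrix.mul_smul, hc', hcc, smul_smul, smul_smul, hs, one_smul]
  · rw [hstar, Matrix.smul_mul, Matrix.mul_smul, hc, smul_smul, smul_smul, hs, one_smul]
  · rw [Matrix.mul_smul, hT, Matrix.smul_mul]

end IrrepMatrix

variable {G : Type*} [TopologicalSpace G] [Group G] [IsTopologicalGroup G]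
  [CompactSpace G] [MeasurableSpace G] [BorelSpace G]
  (μ : Measure G) [IsFiniteMeasure μ] [μ.IsMulLeftInvariant]

namespace IrrepMatrix

/-- Averaging over the group produces intertwining matrices. -/
lemma average_intertwining (ξ η : IrrepMatrix G) (k : Fin ξ.dim) (l : Fin η.dim) (g : G) :
    ξ.mat g * (Matrix.of fun i j => ∫ x, ξ.coeff i k x * conj (η.coeff j l x) ∂μ) =
      (Matrix.of fun i j => ∫ x, ξ.coeff i k x * conj (η.coeff j l x) ∂μ) * η.mat g := by
  ext i j
  -- The matrix is the average of `ξ(x) E_kl η(x)*`. Substituting `x ↦ g x` in `∫ ξ_ik(x) conj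
  -- η_jl(g⁻¹ x)` identifies the two sides.
  have hL : ∫ x, ξ.coeff i k (g * x) * conj (η.coeff j l x) ∂μ =
      ∑ m, ξ.mat g i m * ∫ x, ξ.coeff m k x * conj (η.coeff j l x) ∂μ := by
    simp only [ξ.coeff_mul, Finset.sum_mul]
    rw [integral_finsetSum]
    · exact Finset.sum_congr rfl fun m _ => by
        rw [← integral_const_mul]; simp only [mul_assoc]; rfl
    · exact fun m _ => ContinuousMap.integrable_of_compactSpace μ
        ⟨fun x => ξ.coeff i m g * ξ.coeff m k x * conj (η.coeff j l x), by fun_prop⟩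
  have hR : ∫ x, ξ.coeff i k x * conj (η.coeff j l (g⁻¹ * x)) ∂μ =
      ∑ m, (∫ x, ξ.coeff i k x * conj (η.coeff m l x) ∂μ) * η.mat g m j := by
    simp only [η.coeff_mul, η.coeff_inv, map_sum, map_mul, Complex.conj_conj, Finset.mul_sum]
    rw [integral_finsetSum]
    · exact Finset.sum_congr rfl fun m _ => by
        rw [← integral_mul_const]
        congr 1; ext x; rw [coeff_apply η m j]; ring
    · exact fun m _ => ContinuousMap.integrable_of_compactSpace μ
        ⟨fun x => ξ.coeff i k x * (η.coeff m j g * conj (η.coeff m l x)), by fun_prop⟩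
  have hLR := integral_mul_left_eq_self (μ := μ)
    (fun x => ξ.coeff i k x * conj (η.coeff j l (g⁻¹ * x))) g
  simp only [inv_mul_cancel_left] at hLR
  simp only [Matrix.mul_apply, Matrix.of_apply]
  rw [← hL, ← hR, hLR]

/-- **Schur orthogonality** for inequivalent representations. -/
lemma integral_coeff_mul_conj_coeff_of_not_equivalent {ξ η : IrrepMatrix G}
    (h : ¬ Equivalent ξ η) (i k : Fin ξ.dim) (j l : Fin η.dim) :
    ∫ x, ξ.coeff i k x * conj (η.coeff j l x) ∂μ = 0 := by
  by_contra hne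
  refine h (equivalent_of_intertwining ξ η (fun h0 => hne ?_) (average_intertwining μ ξ η k l))
  exact congrFun (congrFun h0 i) j

/-- **Schur orthogonality** within one representation. -/
lemma integral_coeff_mul_conj_coeff [IsProbabilityMeasure μ] (ξ : IrrepMatrix G)
    (i k j l : Fin ξ.dim) :
    ∫ x, ξ.coeff i k x * conj (ξ.coeff j l x) ∂μ =
      if i = j ∧ k = l then (ξ.dim : ℂ)⁻¹ else 0 := by
  obtain ⟨c, hc⟩ := ξ.exists_eq_smul_one_of_commute (average_intertwining μ ξ ξ k l)
  have hent : ∀ i j, ∫ x, ξ.coeff i k x * conj (ξ.coeff j l x) ∂μ = if i = j then c else 0 :=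
    fun i j => by
      have := congrFun (congrFun hc i) j
      simpa [Matrix.one_apply] using this
  -- The trace determines the scalar: summing over `i = j` integrates the entry `(l, k)` of `ξ* ξ =
  -- 1`.
  have htr : (ξ.dim : ℂ) * c = if k = l then 1 else 0 := by
    calc (ξ.dim : ℂ) * c = ∑ i : Fin ξ.dim, ∫ x, ξ.coeff i k x * conj (ξ.coeff i l x) ∂μ := by
          simp [hent]
      _ = ∫ x, ∑ i : Fin ξ.dim, ξ.coeff i k x * conj (ξ.coeff i l x) ∂μ := by
          rw [integral_finsetSum]
          exact fun i _ => ContinuousMap.integrable_of_compactSpace μ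
            ⟨fun x => ξ.coeff i k x * conj (ξ.coeff i l x), by fun_prop⟩
      _ = ∫ _, (if k = l then 1 else 0 : ℂ) ∂μ := by
          congr 1; ext x
          have := congrFun (congrFun (ξ.conjTranspose_mul_mat x) l) k
          simp only [Matrix.mul_apply, Matrix.conjTranspose_apply, Matrix.one_apply,
            eq_comm (a := l)] at this
          rw [← this]
          exact Finset.sum_congr rfl fun i _ => mul_comm _ _
      _ = if k = l then 1 else 0 := by simp
  have hd : (ξ.dim : ℂ) ≠ 0 := by exact_mod_cast ξ.dim_pos.ne'
  have hcv : c = if k = l then (ξ.dim : ℂ)⁻¹ else 0 := by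
    rw [← mul_right_inj' hd, htr]
    split_ifs <;> simp [hd]
  rw [hent, hcv, ite_and]

lemma norm_coeff_le_one (ξ : IrrepMatrix G) (i j : Fin ξ.dim) (x : G) : ‖ξ.coeff i j x‖ ≤ 1 :=
  entry_norm_bound_of_unitary (ξ.rep x).2 i j

lemma integral_norm_coeff_sq [IsProbabilityMeasure μ] (ξ : IrrepMatrix G) (i j : Fin ξ.dim) :
    ∫ x, ‖ξ.coeff i j x‖ ^ 2 ∂μ = (ξ.dim : ℝ)⁻¹ := by
  have h := ξ.integral_coeff_mul_conj_coeff μ i j i j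
  simp only [Complex.mul_conj', and_self, if_true] at h
  have h2 : ∫ x, ((‖ξ.coeff i j x‖ ^ 2 : ℝ) : ℂ) ∂μ = (((ξ.dim : ℝ)⁻¹ : ℝ) : ℂ) := by
    push_cast; exact h
  rw [integral_complex_ofReal] at h2
  exact_mod_cast h2

/-- The `Lᵠ` norms of matrix coefficients. -/
lemma norm_toLp_coeff_le [IsProbabilityMeasure μ] (ξ : IrrepMatrix G) (i j : Fin ξ.dim)
    (q : ℝ≥0∞) [Fact (1 ≤ q)] {u : C(G, ℂ)} (hu : ∀ x, ‖u x‖ = ‖ξ.coeff i j x‖) :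
    ‖ContinuousMap.toLp q μ ℂ u‖ ≤ (ξ.dim : ℝ) ^ (-((max 2 q)⁻¹).toReal) := by
  have hd : (0 : ℝ) < ξ.dim := by exact_mod_cast ξ.dim_pos
  -- On a probability space the norms increase with the exponent, so `q` may be replaced by `s = max
  -- 2 q`. For finite `s`, `|u| ≤ 1` gives `|u|^s ≤ |u|²`, whose integral is `1/d`; for `s = ∞` the
  -- bound is just `1`.
  have hmono : ‖ContinuousMap.toLp q μ ℂ u‖ ≤ (eLpNorm u (max 2 q) μ).toReal := by
    rw [Lp.norm_def, eLpNorm_congr_ae (ContinuousMap.coeFn_toLp μ u)]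
    have : Fact (1 ≤ max 2 q) := ⟨(Fact.out : 1 ≤ q).trans (le_max_right _ _)⟩
    exact ENNReal.toReal_mono (u.memLp μ (p := max 2 q) ℂ).2.ne
      (eLpNorm_le_eLpNorm_of_exponent_le (le_max_right _ _) u.continuous.aestronglyMeasurable)
  refine hmono.trans ?_
  by_cases htop : max 2 q = ⊤
  · rw [htop]
    simp only [ENNReal.inv_top, ENNReal.toReal_zero, neg_zero, Real.rpow_zero]
    refine ENNReal.toReal_le_of_le_ofReal zero_le_one ?_
    rw [ENNReal.ofReal_one, eLpNorm_exponent_top]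
    refine eLpNormEssSup_le_of_ae_bound (C := 1) ?_ |>.trans (by simp)
    exact Eventually.of_forall fun x => (hu x).trans_le (ξ.norm_coeff_le_one i j x)
  · set s := (max 2 q).toReal with hs
    have hs2 : 2 ≤ s := by
      have := ENNReal.toReal_mono htop (le_max_left 2 q)
      simpa using this
    have hne : max 2 q ≠ 0 := (lt_of_lt_of_le (by norm_num) (le_max_left 2 q)).ne'
    have hcont : ∀ t : ℝ, 0 ≤ t → Integrable (fun x => ‖u x‖ ^ t) μ := fun t ht =>
      (u.continuous.norm.rpow_const (fun _ => Or.inr ht)).integrable_of_hasCompactSupport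
        (HasCompactSupport.of_compactSpace _)
    have : Fact (1 ≤ max 2 q) := ⟨(Fact.out : 1 ≤ q).trans (le_max_right _ _)⟩
    rw [(u.memLp μ (p := max 2 q) ℂ).eLpNorm_eq_integral_rpow_norm hne htop, ← hs,
      ENNReal.toReal_ofReal (by positivity), ENNReal.toReal_inv, ← hs,
      Real.rpow_neg hd.le, ← Real.inv_rpow hd.le, ← ξ.integral_norm_coeff_sq μ i j]
    refine Real.rpow_le_rpow (integral_nonneg fun x => by positivity) ?_ (by positivity)
    refine integral_mono (hcont s (by linarith)) ?_ fun x => ?_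
    · simpa [hu] using hcont 2 (by norm_num)
    · simp only [hu, ← Real.rpow_two]
      exact Real.rpow_le_rpow_of_exponent_ge_of_imp (norm_nonneg _) (ξ.norm_coeff_le_one i j x)
        hs2 (fun _ h => absurd h (by linarith))

end IrrepMatrix

end Schur

/-! ### Schatten norms of diagonal matrices -/

section Schatten

variable {n : Type*} [Fintype n] [DecidableEq n]

lemma cfcAbs_diagonal (d : n → ℂ) :
    CFC.abs (Matrix.diagonal d) = Matrix.diagonal fun i => (‖d i‖ : ℂ) := by
  have h0 : (0 : Matrix n n ℂ) ≤ Matrix.diagonal fun i => (‖d i‖ : ℂ) := by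
    open scoped ComplexOrder in
    rw [Matrix.nonneg_iff_posSemidef]
    exact Matrix.PosSemidef.diagonal fun i => by
      change (0 : ℂ) ≤ (‖d i‖ : ℂ)
      exact_mod_cast norm_nonneg _
  rw [CFC.abs, CFC.sqrt_eq_iff _ _ (star_mul_self_nonneg _) h0, Matrix.star_eq_conjTranspose,
    Matrix.diagonal_conjTranspose, Matrix.diagonal_mul_diagonal, Matrix.diagonal_mul_diagonal]
  congr 1
  ext i
  rw [Pi.star_apply, Complex.star_def, Complex.conj_mul', sq]

/-- The functional calculus sees only the finite spectrum `{d i}`, so `x ^ r` may be replaced by its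
Lagrange interpolant, and polynomials act entrywise on diagonal matrices. -/
lemma rpow_diagonal_ofReal {d : n → ℝ} (hd : ∀ i, 0 ≤ d i) (r : ℝ) :
    (Matrix.diagonal fun i => (d i : ℂ)) ^ r = Matrix.diagonal fun i => ((d i ^ r : ℝ) : ℂ) := by
  have h0 : (0 : Matrix n n ℂ) ≤ Matrix.diagonal fun i => (d i : ℂ) := by
    open scoped ComplexOrder in
    rw [Matrix.nonneg_iff_posSemidef]
    exact Matrix.PosSemidef.diagonal fun i => by
      change (0 : ℂ) ≤ (d i : ℂ)
      exact_mod_cast hd i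
  rw [CFC.rpow_eq_cfc_real]
  let P : Polynomial ℝ := Lagrange.interpolate (Finset.univ.image d) id fun x => x ^ r
  have hP : ∀ i, P.eval (d i) = d i ^ r := fun i =>
    Lagrange.eval_interpolate_at_node (v := id) _ (Set.injOn_id _)
      (Finset.mem_image_of_mem d (Finset.mem_univ i))
  have hcongr : cfc (fun x : ℝ => x ^ r) (Matrix.diagonal fun i => (d i : ℂ)) =
      cfc P.eval (Matrix.diagonal fun i => (d i : ℂ)) := by
    refine cfc_congr fun x hx => ?_
    obtain ⟨i, rfl⟩ : ∃ i, d i = x := by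
      rw [← spectrum.algebraMap_mem_iff ℂ, spectrum_diagonal] at hx
      exact hx.imp fun i hi => Complex.ofReal_injective hi
    exact (hP i).symm
  rw [hcongr, cfc_polynomial _ _ h0.isSelfAdjoint]
  have h1 : (Matrix.diagonal fun i => (d i : ℂ)) =
      Matrix.diagonalAlgHom ℝ (fun i => (d i : ℂ)) := rfl
  rw [h1, Polynomial.aeval_algHom_apply]
  change Matrix.diagonal _ = _
  congr 1
  ext i
  rw [Polynomial.aeval_pi_apply, ← hP i]
  exact Polynomial.aeval_algebraMap_apply_eq_algebraMap_eval _ _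

/-- The Schatten norm of a diagonal matrix. -/
lemma schattenNorm_rpow_of_isDiag {M : Matrix n n ℂ} (hM : M.IsDiag) {r : ℝ} (hr : 0 < r) :
    schattenNorm r M ^ r = ∑ i, ‖M i i‖ ^ r := by
  have h : Matrix.trace (CFC.abs M ^ r) = ((∑ i, ‖M i i‖ ^ r : ℝ) : ℂ) := by
    conv_lhs => rw [← hM.diagonal_diag]
    rw [cfcAbs_diagonal, rpow_diagonal_ofReal fun i => norm_nonneg _, Matrix.trace_diagonal]
    simp
  rw [schattenNorm, h, Complex.ofReal_re, ← Real.rpow_mul (by positivity),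
    one_div_mul_cancel hr.ne', Real.rpow_one]

end Schatten

/-! ### Nuclear operators from summable families of rank one operators -/

section Nuclear

variable {E F : Type*} [NormedAddCommGroup E] [NormedSpace ℂ E]
  [NormedAddCommGroup F] [NormedSpace ℂ F]

/-- Nuclear representations may be indexed by an arbitrary type. -/
lemma IsRNuclear.of_hasSum {ι : Type*} {r : ℝ} (hr : 0 < r) {T : E →ₗ[ℂ] F}
    (x' : ι → StrongDual ℂ E) (y : ι → F)
    (hs : Summable fun i => ‖x' i‖ ^ r * ‖y i‖ ^ r)
    (hT : ∀ x, HasSum (fun i => x' i x • y i) (T x)) : IsRNuclear r T := by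
  -- A summable family has countable support, so `s` embeds in `ℕ`. Extension by zero is harmless:
  -- `0 ^ r = 0` for `r > 0`, and outside `s` one factor of each rank one term vanishes.
  set s := Function.support fun i => ‖x' i‖ ^ r * ‖y i‖ ^ r
  have : Countable s := hs.countable_support.to_subtype
  obtain ⟨e, he⟩ := exists_injective_nat s
  have hsupp : ∀ x, Function.support (fun i => x' i x • y i) ⊆ s := by
    intro x i hi his
    apply hi
    have h0 : ‖x' i‖ ^ r * ‖y i‖ ^ r = 0 := his
    rcases mul_eq_zero.1 h0 with h | h
    · have : x' i = 0 := norm_eq_zero.1 ((Real.rpow_eq_zero (norm_nonneg _) hr.ne').1 h)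
      simp [this]
    · have : y i = 0 := norm_eq_zero.1 ((Real.rpow_eq_zero (norm_nonneg _) hr.ne').1 h)
      simp [this]
  refine ⟨Function.extend e (fun i => x' i) 0, Function.extend e (fun i => y i) 0, ?_, ?_⟩
  · rw [← he.summable_iff]
    · refine (hs.subtype s).congr fun i => ?_
      simp [he.extend_apply]
    · intro n hn
      rw [Function.extend_apply' _ _ _ hn]
      simp [Real.zero_rpow hr.ne']
  · intro x
    rw [← he.hasSum_iff]
    · have := (hasSum_subtype_iff_of_support_subset (hsupp x)).2 (hT x)
      simpa [Function.comp_def, he.extend_apply] using this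
    · intro n hn
      rw [Function.extend_apply' _ _ _ hn]
      simp

/-- All but finitely many terms are at most one, where `a ≤ a ^ r` because `r ≤ 1`. -/
lemma summable_of_summable_rpow {ι : Type*} {a : ι → ℝ} (ha : ∀ i, 0 ≤ a i) {r : ℝ}
    (hr₀ : 0 < r) (hr₁ : r ≤ 1) (hs : Summable fun i => a i ^ r) : Summable a := by
  refine Summable.of_norm_bounded_eventually hs ?_
  filter_upwards [hs.tendsto_cofinite_zero.eventually (gt_mem_nhds one_pos)] with i hi
  have h1 : a i ≤ 1 := by
    by_contra! h
    exact absurd hi (not_lt.2 (Real.one_le_rpow h.le hr₀.le))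
  rw [Real.norm_of_nonneg (ha i)]
  simpa using Real.rpow_le_rpow_of_exponent_ge_of_imp (ha i) h1 hr₁ (fun _ h => absurd h one_ne_zero)

/-- A continuous operator that agrees on a set with dense span with an `r`-summable series of rank
one operators is `r`-nuclear. -/
lemma IsRNuclear.of_eqOn_dense [CompleteSpace F] {ι : Type*} {r : ℝ} (hr₀ : 0 < r) (hr₁ : r ≤ 1)
    (A : E →L[ℂ] F) (x' : ι → StrongDual ℂ E) (y : ι → F)
    (hs : Summable fun i => ‖x' i‖ ^ r * ‖y i‖ ^ r) {S : Set E}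
    (hS : Dense (Submodule.span ℂ S : Set E))
    (hA : ∀ x ∈ S, HasSum (fun i => x' i x • y i) (A x)) :
    IsRNuclear r (A : E →ₗ[ℂ] F) := by
  have hs1 : Summable fun i => ‖x' i‖ * ‖y i‖ :=
    summable_of_summable_rpow (fun i => by positivity) hr₀ hr₁ <| by
      simpa only [Real.mul_rpow (norm_nonneg _) (norm_nonneg _)] using hs
  have hop : Summable fun i => (x' i).smulRight (y i) := by
    refine Summable.of_norm (hs1.congr fun i => ?_)
    rw [ContinuousLinearMap.norm_smulRight_apply]
  have happ : ∀ x, HasSum (fun i => x' i x • y i) ((∑' i, (x' i).smulRight (y i)) x) := fun x =>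
    hop.hasSum.mapL (ContinuousLinearMap.apply ℂ F x)
  have hAB : A = ∑' i, (x' i).smulRight (y i) :=
    ContinuousLinearMap.ext_on hS fun x hx => (hA x hx).unique (happ x)
  exact IsRNuclear.of_hasSum hr₀ x' y hs fun x => by rw [hAB]; exact happ x

end Nuclear

/-! ### Diagonal Fourier multipliers between Lebesgue spaces -/

section Multiplier

section Pairing

variable {X : Type*} [MeasurableSpace X] {μ : Measure X}

lemma norm_lpPairing_mul_le {p q : ℝ≥0∞} [Fact (1 ≤ p)] [Fact (1 ≤ q)] [q.HolderConjugate p]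
    (u : Lp ℂ q μ) :
    ‖(ContinuousLinearMap.mul ℂ ℂ).lpPairing μ q p u‖ ≤ ‖u‖ := by
  refine ContinuousLinearMap.opNorm_le_bound _ (norm_nonneg u) fun f => ?_
  have h1 := (ContinuousLinearMap.mul ℂ ℂ).norm_holder_apply_apply_le (r := 1) u f
  have h2 : (ContinuousLinearMap.mul ℂ ℂ).lpPairing μ q p u f =
      ∫ x, (ContinuousLinearMap.mul ℂ ℂ).holder 1 u f x ∂μ := by
    rw [ContinuousLinearMap.lpPairing_eq_integral]
    exact integral_congr_ae ((ContinuousLinearMap.mul ℂ ℂ).coeFn_holder u f).symm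
  rw [h2, ← L1.integral_eq_integral]
  refine (L1.norm_integral_le _).trans (h1.trans ?_)
  rw [ContinuousLinearMap.opNorm_mul, one_mul]

lemma inv_toReal_max_two {p : ℝ≥0∞} (hp : p ≠ ⊤) :
    ((max 2 p)⁻¹).toReal = 1 / max 2 p.toReal := by
  rw [ENNReal.toReal_inv, ENNReal.toReal_max (by norm_num) hp, one_div, ENNReal.toReal_ofNat]

/-- Conjugation of exponents reverses order and fixes `2`, so `max 2 q` is conjugate to `min 2 p`.
-/
lemma inv_toReal_max_two_of_holderConjugate {p q : ℝ≥0∞} [hpq : q.HolderConjugate p]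
    (hp : p ≠ ⊤) : ((max 2 q)⁻¹).toReal = 1 - 1 / min 2 p.toReal := by
  have hp1 : 1 ≤ p := ENNReal.HolderConjugate.one_le p q
  have hq1 : 1 ≤ q := ENNReal.HolderConjugate.one_le q p
  have hqp : (q⁻¹).toReal + p.toReal⁻¹ = 1 := by
    rw [← ENNReal.toReal_inv, ← ENNReal.toReal_add,
      ENNReal.HolderConjugate.inv_add_inv_eq_one q p, ENNReal.toReal_one]
    · exact ENNReal.inv_ne_top.2 (one_pos.trans_le hq1).ne'
    · exact ENNReal.inv_ne_top.2 (one_pos.trans_le hp1).ne'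
  have hpos : 0 < p.toReal := ENNReal.toReal_pos (one_pos.trans_le hp1).ne' hp
  rcases le_total 2 q with h | h
  · have h1 : (q⁻¹).toReal ≤ 2⁻¹ := by
      have := ENNReal.toReal_mono (by norm_num) (ENNReal.inv_le_inv.2 h)
      simpa using this
    have h2 : p.toReal ≤ 2 := by
      rw [← inv_le_inv₀ two_pos hpos]; linarith
    rw [max_eq_right h, min_eq_right h2, one_div]; linarith
  · have h1 : 2⁻¹ ≤ (q⁻¹).toReal := by
      have := ENNReal.toReal_mono (ENNReal.inv_ne_top.2 (one_pos.trans_le hq1).ne')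
        (ENNReal.inv_le_inv.2 h)
      simpa using this
    have h2 : 2 ≤ p.toReal := by
      rw [← inv_le_inv₀ hpos two_pos]; linarith
    rw [max_eq_left h, min_eq_left h2]; norm_num

end Pairing

variable {G : Type*} [TopologicalSpace G] [Group G] [IsTopologicalGroup G]
  [CompactSpace G] [MeasurableSpace G] [BorelSpace G]
  {μ : Measure G} [IsProbabilityMeasure μ] [μ.IsMulLeftInvariant]
  {p₁ p₂ : ℝ≥0∞} [Fact (1 ≤ p₁)] [Fact (1 ≤ p₂)]

/-- An invariant operator with diagonal symbol acts diagonally on matrix coefficients. -/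
lemma apply_coeff_of_matrixSymbol_isDiag {A : Lp ℂ p₁ μ →L[ℂ] Lp ℂ p₂ μ} {ξ : IrrepMatrix G}
    {σ : Matrix (Fin ξ.dim) (Fin ξ.dim) ℂ} (hσ : ∀ᵐ x ∂μ, matrixSymbol A ξ x = σ)
    (hdiag : σ.IsDiag) (i j : Fin ξ.dim) :
    A (ContinuousMap.toLp p₁ μ ℂ (ξ.coeff i j)) =
      σ j j • ContinuousMap.toLp p₂ μ ℂ (ξ.coeff i j) := by
  apply Lp.ext
  filter_upwards [hσ, Lp.coeFn_smul (σ j j) (ContinuousMap.toLp p₂ μ ℂ (ξ.coeff i j)),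
    ContinuousMap.coeFn_toLp (p := p₂) (𝕜 := ℂ) μ (ξ.coeff i j)] with x h1 h2 h3
  rw [h2, Pi.smul_apply, h3, ← h1, smul_eq_mul]
  -- Multiplying the symbol by the unitary `ξ(x)` recovers `(A ξ)(x) = ξ(x) σ`, whose column `j` is
  -- `σ_jj` times that of `ξ(x)`.
  have h4 := congrArg (fun M => (ξ.mat x * M) i j) h1
  simp only [matrixSymbol, ← Matrix.mul_assoc, ξ.mat_mul_conjTranspose, Matrix.one_mul,
    Matrix.of_apply] at h4
  rw [h4, Matrix.mul_apply, Finset.sum_eq_single j, h1, ξ.coeff_apply, mul_comm]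
  · intro k _ hk
    rw [hdiag hk, mul_zero]
  · simp

/-- The nuclear norm of the rank one terms in the expansion of a diagonal multiplier. -/
lemma norm_rankOne_coeff_le {q : ℝ≥0∞} [Fact (1 ≤ q)] [q.HolderConjugate p₁]
    (hp₁ : p₁ ≠ ⊤) (hp₂ : p₂ ≠ ⊤) {r : ℝ} (hr : 0 < r) (ξ : IrrepMatrix G) (i j : Fin ξ.dim)
    (c : ℂ) :
    ‖((ξ.dim : ℂ) * c) • (ContinuousLinearMap.mul ℂ ℂ).lpPairing μ q p₁
        (ContinuousMap.toLp q μ ℂ (star (ξ.coeff i j)))‖ ^ r *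
      ‖ContinuousMap.toLp p₂ μ ℂ (ξ.coeff i j)‖ ^ r ≤
    (ξ.dim : ℝ) ^ ((1 / min 2 p₁.toReal - 1 / max 2 p₂.toReal) * r) * ‖c‖ ^ r := by
  have hd : (0 : ℝ) < ξ.dim := by exact_mod_cast ξ.dim_pos
  have h1 := (norm_lpPairing_mul_le (p := p₁) _).trans
    (ξ.norm_toLp_coeff_le μ i j q (u := star (ξ.coeff i j)) fun x => by simp)
  have h2 := ξ.norm_toLp_coeff_le μ i j p₂ (u := ξ.coeff i j) fun x => rfl
  rw [inv_toReal_max_two_of_holderConjugate hp₁] at h1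
  rw [inv_toReal_max_two hp₂] at h2
  rw [← Real.mul_rpow (norm_nonneg _) (norm_nonneg _), Real.rpow_mul hd.le,
    ← Real.mul_rpow (by positivity) (norm_nonneg _)]
  refine Real.rpow_le_rpow (by positivity) ?_ hr.le
  rw [norm_smul, norm_mul, Complex.norm_natCast]
  calc (ξ.dim : ℝ) * ‖c‖ * _ * _
      ≤ ξ.dim * ‖c‖ * (ξ.dim : ℝ) ^ (-(1 - 1 / min 2 p₁.toReal)) *
        (ξ.dim : ℝ) ^ (-(1 / max 2 p₂.toReal)) := by gcongr
    _ = (ξ.dim : ℝ) ^ (1 : ℝ) * (ξ.dim : ℝ) ^ (-(1 - 1 / min 2 p₁.toReal)) *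
        (ξ.dim : ℝ) ^ (-(1 / max 2 p₂.toReal)) * ‖c‖ := by rw [Real.rpow_one]; ring
    _ = _ := by
        rw [← Real.rpow_add hd, ← Real.rpow_add hd]
        congr 2; ring

theorem isRNuclear_of_diagonal_matrixSymbol [T2Space G] [SecondCountableTopology G]
    [μ.IsOpenPosMeasure] [μ.WeaklyRegular] (hp₁ : p₁ ≠ ⊤) (hp₂ : p₂ ≠ ⊤)
    {r : ℝ} (hr₀ : 0 < r) (hr₁ : r ≤ 1)
    (A : Lp ℂ p₁ μ →L[ℂ] Lp ℂ p₂ μ)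
    (ξ : UnitaryDual G → IrrepMatrix G) (hξ : ∀ π, UnitaryDual.mk (ξ π) = π)
    (σ : ∀ π, Matrix (Fin (ξ π).dim) (Fin (ξ π).dim) ℂ)
    (hσ : ∀ π, ∀ᵐ x ∂μ, matrixSymbol A (ξ π) x = σ π)
    (hdiag : ∀ π, (σ π).IsDiag)
    (hsum : Summable fun π : UnitaryDual G =>
      ((ξ π).dim : ℝ) ^ (1 + (1 / min 2 p₁.toReal - 1 / max 2 p₂.toReal) * r) *
        schattenNorm r (σ π) ^ r) :
    IsRNuclear r (A : Lp ℂ p₁ μ →ₗ[ℂ] Lp ℂ p₂ μ) := by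
  let q := ENNReal.conjExponent p₁
  have hqp : q.HolderConjugate p₁ := inferInstance
  have hq : Fact (1 ≤ q) := ⟨ENNReal.HolderConjugate.one_le q p₁⟩
  -- The functional `f ↦ d σ_jj ∫ f conj ξ_ij`; the conjugate exponent `q` is infinite when `p₁ =
  -- 1`.
  let x' : (Σ π : UnitaryDual G, Fin (ξ π).dim × Fin (ξ π).dim) → StrongDual ℂ (Lp ℂ p₁ μ) :=
    fun a => (((ξ a.1).dim : ℂ) * σ a.1 a.2.2 a.2.2) •
      (ContinuousLinearMap.mul ℂ ℂ).lpPairing μ q p₁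
        (ContinuousMap.toLp q μ ℂ (star ((ξ a.1).coeff a.2.1 a.2.2)))
  let y : (Σ π : UnitaryDual G, Fin (ξ π).dim × Fin (ξ π).dim) → Lp ℂ p₂ μ :=
    fun a => ContinuousMap.toLp p₂ μ ℂ ((ξ a.1).coeff a.2.1 a.2.2)
  refine IsRNuclear.of_eqOn_dense hr₀ hr₁ A x' y ?_
    (S := {f | ∃ (π : UnitaryDual G) (i j : Fin (ξ π).dim),
      f = ContinuousMap.toLp p₁ μ ℂ ((ξ π).coeff i j)}) ?_ ?_
  · refine Summable.of_nonneg_of_le (fun a => by positivity)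
      (fun a => norm_rankOne_coeff_le hp₁ hp₂ hr₀ (ξ a.1) a.2.1 a.2.2 _) ?_
    rw [summable_sigma_of_nonneg fun a => by positivity]
    refine ⟨fun π => Summable.of_finite, hsum.congr fun π => ?_⟩
    have hd : (0 : ℝ) < (ξ π).dim := by exact_mod_cast (ξ π).dim_pos
    rw [tsum_fintype]
    -- The terms do not depend on the row index, which therefore contributes the extra factor `d`,
    -- the `1 +` in the exponent of the hypothesis.
    have hprod : ∀ (m : ℕ) (f : Fin m → ℝ), ∑ b : Fin m × Fin m, f b.2 = m * ∑ j, f j := by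
      intro m f
      simp [Fintype.sum_prod_type]
    refine Eq.trans ?_ (hprod (ξ π).dim fun j => ((ξ π).dim : ℝ) ^
      ((1 / min 2 p₁.toReal - 1 / max 2 p₂.toReal) * r) * ‖σ π j j‖ ^ r).symm
    rw [← Finset.mul_sum, schattenNorm_rpow_of_isDiag (hdiag π) hr₀, Real.rpow_add hd,
      Real.rpow_one, mul_assoc]
  · refine (dense_map_matrixCoeffSpan μ hp₁).mono ?_
    rintro _ ⟨f, hf, rfl⟩
    have hle : Submodule.span ℂ
        {f | ∃ (π : UnitaryDual G) (i j : Fin (ξ π).dim), f = (ξ π).coeff i j} ≤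
        (Submodule.span ℂ {f | ∃ (π : UnitaryDual G) (i j : Fin (ξ π).dim),
          f = ContinuousMap.toLp p₁ μ ℂ ((ξ π).coeff i j)}).comap
          (ContinuousMap.toLp (E := ℂ) p₁ μ ℂ).toLinearMap := by
      refine Submodule.span_le.2 ?_
      rintro _ ⟨π, i, j, rfl⟩
      exact Submodule.subset_span ⟨π, i, j, rfl⟩
    exact hle (matrixCoeffSpan_le_span_of_representatives ξ hξ hf)
  · rintro _ ⟨π, k, l, rfl⟩
    have hpair : ∀ (η : IrrepMatrix G) (i j : Fin η.dim),
        (ContinuousLinearMap.mul ℂ ℂ).lpPairing μ q p₁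
          (ContinuousMap.toLp q μ ℂ (star (η.coeff i j)))
          (ContinuousMap.toLp p₁ μ ℂ ((ξ π).coeff k l)) =
        ∫ x, (ξ π).coeff k l x * conj (η.coeff i j x) ∂μ := by
      intro η i j
      rw [ContinuousLinearMap.lpPairing_eq_integral]
      refine integral_congr_ae ?_
      filter_upwards [ContinuousMap.coeFn_toLp (p := q) (𝕜 := ℂ) μ (star (η.coeff i j)),
        ContinuousMap.coeFn_toLp (p := p₁) (𝕜 := ℂ) μ ((ξ π).coeff k l)] with x h1 h2
      rw [h1, h2, ContinuousLinearMap.mul_apply', mul_comm]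
      rfl
    have hd : ((ξ π).dim : ℂ) ≠ 0 := by exact_mod_cast (ξ π).dim_pos.ne'
    have happly : ∀ (π' : UnitaryDual G) (i j : Fin (ξ π').dim),
        x' ⟨π', i, j⟩ (ContinuousMap.toLp p₁ μ ℂ ((ξ π).coeff k l)) =
          (((ξ π').dim : ℂ) * σ π' j j) *
            ∫ x, (ξ π).coeff k l x * conj ((ξ π').coeff i j x) ∂μ := fun π' i j => by
      rw [← hpair]; rfl
    -- By Schur orthogonality only this term survives on `ξ_kl`; the factor `d` in `x'` cancels the
    -- `1/d` from the integral.
    have hval : x' ⟨π, k, l⟩ (ContinuousMap.toLp p₁ μ ℂ ((ξ π).coeff k l)) • y ⟨π, k, l⟩ =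
        A (ContinuousMap.toLp p₁ μ ℂ ((ξ π).coeff k l)) := by
      rw [apply_coeff_of_matrixSymbol_isDiag (hσ π) (hdiag π), happly,
        (ξ π).integral_coeff_mul_conj_coeff μ, if_pos ⟨rfl, rfl⟩,
        mul_right_comm, mul_inv_cancel₀ hd, one_mul]
    rw [← hval]
    refine hasSum_single (⟨π, k, l⟩ : Σ π : UnitaryDual G, Fin (ξ π).dim × Fin (ξ π).dim) ?_
    rintro ⟨π', i, j⟩ hne
    rw [happly]
    by_cases hπ : π = π'
    · subst hπ
      rw [(ξ π).integral_coeff_mul_conj_coeff μ, if_neg, mul_zero, zero_smul]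
      rintro ⟨rfl, rfl⟩
      exact hne rfl
    · rw [IrrepMatrix.integral_coeff_mul_conj_coeff_of_not_equivalent, mul_zero, zero_smul]
      intro h
      exact hπ (by rw [← hξ π, ← hξ π']; exact Quotient.sound h)

end Multiplier

theorem mainTheorem7
    {E : Type*} [NormedAddCommGroup E] [NormedSpace ℝ E] [FiniteDimensional ℝ E]
    {H : Type*} [TopologicalSpace H] (I : ModelWithCorners ℝ E H) [I.Boundaryless]
    {G : Type*} [TopologicalSpace G] [ChartedSpace H G] [Group G] [LieGroup I ∞ G]
    [CompactSpace G] [T2Space G]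
    [MeasurableSpace G] [BorelSpace G]
    (μ : Measure G) [μ.IsHaarMeasure] [IsProbabilityMeasure μ]
    (p₁ p₂ : ℝ≥0∞) [Fact (1 ≤ p₁)] [Fact (1 ≤ p₂)] (hp₁ : p₁ ≠ ⊤) (hp₂ : p₂ ≠ ⊤)
    (r : ℝ) (hr₀ : 0 < r) (hr₁ : r ≤ 1)
    (A : Lp ℂ p₁ μ →L[ℂ] Lp ℂ p₂ μ)
    (ξ : UnitaryDual G → IrrepMatrix G) (hξ : ∀ π, UnitaryDual.mk (ξ π) = π)
    (σ : ∀ π, Matrix (Fin (ξ π).dim) (Fin (ξ π).dim) ℂ)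
    (hσ : ∀ π, ∀ᵐ x ∂μ, matrixSymbol A (ξ π) x = σ π)
    (hdiag : ∀ π, (σ π).IsDiag)
    (hsum : Summable fun π : UnitaryDual G =>
      ((ξ π).dim : ℝ) ^ (1 + (1 / min 2 p₁.toReal - 1 / max 2 p₂.toReal) * r) *
        schattenNorm r (σ π) ^ r) :
    IsRNuclear r (A : Lp ℂ p₁ μ →ₗ[ℂ] Lp ℂ p₂ μ) := by
  -- The Lie structure enters only here: it makes `G` a topological group and, with compactness,
  -- second countable.
  have := I.secondCountableTopology
  have := ChartedSpace.secondCountable_of_sigmaCompact H G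
  have := topologicalGroup_of_lieGroup I ∞ (G := G)
  exact isRNuclear_of_diagonal_matrixSymbol hp₁ hp₂ hr₀ hr₁ A ξ hξ σ hσ hdiag hsum
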